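/- Let $K_n$ be the complete graph on $n$ vertices. A $K_{1,t+1}$-matroid on $K_n$ is a matroid whose ground set is the edge set $E(K_n)$ and in which the edge set of every subgraph of $K_n$ isomorphic to the star $K_{1,t+1}$ is a circuit. Order the matroids on $E(K_n)$ by the weak order: $M\preceq N$ if and only if every independent set of $M$ is independent in $N$. A $K_{1,t+1}$-matroid $M$ on $K_n$ is maximal if there is no $K_{1,t+1}$-matroid $N\neq M$ on $K_n$ with $M\preceq N$. Then, for all integers $t\geq 4$ and $n\geq t+2$, there exist two distinct maximal $K_{1,t+1}$-matroids on $K_n$. -/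

import Mathlib

/-- `M ≼ N` in the weak order of matroids: `M` and `N` have the same ground set and every
independent set of `M` is independent in `N`. -/
def Matroid.WeakLE {α : Type*} (M N : Matroid α) : Prop :=
  M.E = N.E ∧ ∀ I : Set α, M.Indep I → N.Indep I

/-- `M` is an `H`-matroid on the complete graph with vertex set `V`: its ground set is the set of
all edges of the complete graph, and the edge set of every subgraph isomorphic to `H` is a
circuit. -/
structure IsGraphMatroid {V W : Type*} (H : SimpleGraph W) (M : Matroid (Sym2 V)) : Prop where
  ground_eq : M.E = (⊤ : SimpleGraph V).edgeSet
  isCircuit_copy : ∀ f : SimpleGraph.Copy H (⊤ : SimpleGraph V), M.IsCircuit f.toSubgraph.edgeSet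

/-- `M` is a maximal element, in the weak order, of the family of all `H`-matroids on the complete
graph with vertex set `V`. -/
def IsMaximalGraphMatroid {V W : Type*} (H : SimpleGraph W) (M : Matroid (Sym2 V)) : Prop :=
  IsGraphMatroid H M ∧
    ∀ N : Matroid (Sym2 V), IsGraphMatroid H N → M.WeakLE N → N = M

/-- The star `K_{1,m}`. -/
abbrev starGraphK (m : ℕ) : SimpleGraph (Fin 1 ⊕ Fin m) :=
  completeBipartiteGraph (Fin 1) (Fin m)

/-! On a finite set of edges every `K_{1,t+1}`-matroid lies below a maximal one. So it suffices to
find two such matroids with no common upper bound, since maximal matroids above them then differ.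
The obstruction is a clique `K_{t+1}` inside the vertex set of a `K_{3,t-1}`. In any
`K_{1,t+1}`-matroid the edges meeting a set of m ≤ t vertices have rank at most t + (t-1) + ... +
(t-m+1). Apply submodularity of rank to the edges meeting each side of `K_{3,t-1}`: if both graphs
were independent, the lower bound 3(t-1) + C(t+1,2) would exceed the upper bound by exactly one
(`IsGraphMatroid.not_indep_crossEdges`). Each graph is nevertheless independent in some
`K_{1,t+1}`-matroid. For the clique, represent uv by the product of evaluations at u and v on
polynomials of degree less than t. For `K_{3,t-1}`, use a combinatorial rank that minimises, over
vertex sets X, the number of edges avoiding X plus a weight depending on |X|. -/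

open Finset

/-! ### Matroids from rank functions -/

/-- A normalised, monotone and submodular function on finite sets. -/
structure IsRankFun {α : Type*} [DecidableEq α] (r : Finset α → ℕ) : Prop where
  le_card : ∀ F, r F ≤ #F
  mono : ∀ F G, F ⊆ G → r F ≤ r G
  submod : ∀ F G, r (F ∪ G) + r (F ∩ G) ≤ r F + r G

theorem IsRankFun.eq_card_of_subset {α : Type*} [DecidableEq α] {r : Finset α → ℕ}
    (hr : IsRankFun r) {I J : Finset α} (hJ : r J = #J) (hIJ : I ⊆ J) : r I = #I := by
  have h1 := hr.submod I (J \ I)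
  rw [union_sdiff_of_subset hIJ] at h1
  have h2 := hr.le_card (J \ I)
  have h3 := card_sdiff_add_card_eq_card hIJ
  have h4 := hr.le_card I
  omega

theorem IsRankFun.union_eq {α : Type*} [DecidableEq α] {r : Finset α → ℕ}
    (hr : IsRankFun r) {I J : Finset α} (h : ∀ e ∈ J, r (insert e I) = r I) :
    r (I ∪ J) = r I := by
  induction J using Finset.induction_on with
  | empty => simp
  | insert a s ha ih =>
    have h1 := ih fun e he ↦ h e (mem_insert_of_mem he)
    have h2 := h a (mem_insert_self a s)
    have h3 := hr.submod (I ∪ s) (insert a I)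
    have h4 := hr.mono I ((I ∪ s) ∩ insert a I)
      (subset_inter subset_union_left (subset_insert a I))
    have h5 : (I ∪ s) ∪ insert a I = I ∪ insert a s := by grind
    have h6 := hr.mono I (I ∪ insert a s) subset_union_left
    rw [h5] at h3
    omega

/-- The matroid on `E` whose independent sets are the finite sets of full rank. -/
theorem IsRankFun.exists_matroid {α : Type*} [DecidableEq α] {r : Finset α → ℕ}
    (hr : IsRankFun r) (E : Set α) :
    ∃ M : Matroid α, M.E = E ∧ ∀ I : Finset α, M.Indep I ↔ r I = #I ∧ (I : Set α) ⊆ E := by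
  refine ⟨(IndepMatroid.ofFinset E (fun I ↦ r I = #I ∧ (I : Set α) ⊆ E) ?_ ?_ ?_ ?_).matroid,
    rfl, fun I ↦ ?_⟩
  · simpa using hr.le_card ∅
  · exact fun I J hJ hIJ ↦
      ⟨hr.eq_card_of_subset hJ.1 hIJ, (Finset.coe_subset.2 hIJ).trans hJ.2⟩
  · intro I J hI hJ hlt
    by_contra! hcon
    have h1 : r (I ∪ J) = r I := by
      refine hr.union_eq fun e he ↦ ?_
      by_cases heI : e ∈ I
      · rw [insert_eq_of_mem heI]
      have h2 : ¬ (r (insert e I) = #(insert e I)) := fun h ↦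
        hcon e he heI h (by
          rw [coe_insert]
          exact Set.insert_subset (hJ.2 (mem_coe.2 he)) hI.2)
      have h3 := hr.le_card (insert e I)
      have h4 := hr.mono I (insert e I) (subset_insert e I)
      rw [card_insert_of_notMem heI] at h2 h3
      have := hI.1
      omega
    have h2 := hr.mono J (I ∪ J) subset_union_right
    have := hI.1
    have := hJ.1
    omega
  · exact fun I hI ↦ hI.2
  · simp

/-! ### Stars, and the clash between a clique and a complete bipartite graph -/

section Star

variable {V : Type*} [DecidableEq V]

/-- The edge set of the star with centre `v` and set of leaves `S`. -/
def starEdges (v : V) (S : Finset V) : Finset (Sym2 V) := S.image fun u ↦ s(v, u)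

theorem mem_starEdges {v : V} {S : Finset V} {e : Sym2 V} :
    e ∈ starEdges v S ↔ ∃ u ∈ S, s(v, u) = e := by
  simp [starEdges]

theorem card_starEdges (v : V) (S : Finset V) : #(starEdges v S) = #S :=
  card_image_of_injective _ fun _ _ h ↦ Sym2.congr_right.1 h

theorem starEdges_subset_edgeSet {v : V} {S : Finset V} (hv : v ∉ S) :
    (starEdges v S : Set (Sym2 V)) ⊆ (⊤ : SimpleGraph V).edgeSet := by
  intro e he
  obtain ⟨u, hu, rfl⟩ := mem_starEdges.1 (mem_coe.1 he)
  simp only [SimpleGraph.mem_edgeSet, SimpleGraph.top_adj]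
  rintro rfl
  exact hv hu

theorem edgeSet_toSubgraph_star {m : ℕ}
    (f : SimpleGraph.Copy (starGraphK m) (⊤ : SimpleGraph V)) :
    f.toSubgraph.edgeSet =
      starEdges (f.toHom (Sum.inl 0)) (univ.image fun i ↦ f.toHom (Sum.inr i)) := by
  ext e
  simp only [SimpleGraph.Copy.toSubgraph, SimpleGraph.Subgraph.edgeSet_map, Set.mem_image,
    mem_coe, mem_starEdges, mem_image, mem_univ, true_and]
  constructor
  · rintro ⟨e, he, rfl⟩
    induction e with | _ a b
    rcases a with a | a <;> rcases b with b | b <;> simp at he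
    · obtain rfl := Subsingleton.elim a 0
      exact ⟨_, ⟨b, rfl⟩, rfl⟩
    · obtain rfl := Subsingleton.elim b 0
      exact ⟨_, ⟨a, rfl⟩, Sym2.eq_swap⟩
  · rintro ⟨_, ⟨i, rfl⟩, rfl⟩
    exact ⟨s(Sum.inl 0, Sum.inr i), by simp, rfl⟩

theorem isGraphMatroid_star_of_indep {t : ℕ} {M : Matroid (Sym2 V)}
    (hE : M.E = (⊤ : SimpleGraph V).edgeSet)
    (hdep : ∀ (v : V) (S : Finset V), v ∉ S → #S = t + 1 → ¬ M.Indep (starEdges v S))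
    (hindep : ∀ (v : V) (S : Finset V), v ∉ S → #S = t → M.Indep (starEdges v S)) :
    IsGraphMatroid (starGraphK (t + 1)) M := by
  refine ⟨hE, fun f ↦ ?_⟩
  rw [edgeSet_toSubgraph_star]
  set v := f.toHom (Sum.inl 0)
  set S := univ.image fun i ↦ f.toHom (Sum.inr i) with hS
  have hv : v ∉ S := by
    simp only [hS, mem_image, mem_univ, true_and, not_exists]
    intro i hi
    simpa using f.injective' hi
  have hc : #S = t + 1 := by
    rw [hS, card_image_of_injective, card_fin]
    exact fun a b h ↦ by simpa using f.injective' h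
  rw [Matroid.isCircuit_iff_dep_forall_sdiff_singleton_indep]
  refine ⟨⟨hdep v S hv hc, hE ▸ starEdges_subset_edgeSet hv⟩, fun e he ↦ ?_⟩
  obtain ⟨u, hu, rfl⟩ := mem_starEdges.1 (mem_coe.1 he)
  convert hindep v (S.erase u) (fun h ↦ hv (mem_of_mem_erase h))
    (by rw [card_erase_of_mem hu, hc]; rfl) using 1
  ext e
  simp only [Set.mem_sdiff, mem_coe, mem_starEdges, Set.mem_singleton_iff, mem_erase]
  constructor
  · rintro ⟨⟨w, hw, rfl⟩, h⟩
    exact ⟨w, ⟨fun h' ↦ h (by rw [h']), hw⟩, rfl⟩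
  · rintro ⟨w, ⟨hwu, hw⟩, rfl⟩
    exact ⟨⟨w, hw, rfl⟩, fun h ↦ hwu (Sym2.congr_right.1 h)⟩

theorem IsGraphMatroid.isCircuit_star {t : ℕ} {M : Matroid (Sym2 V)}
    (hM : IsGraphMatroid (starGraphK (t + 1)) M) {v : V} {S : Finset V} (hv : v ∉ S)
    (hS : #S = t + 1) : M.IsCircuit (starEdges v S) := by
  let g : Fin (t + 1) ≃ S := (S.equivFinOfCardEq hS).symm
  have hg : ∀ i, v ≠ (g i : V) := fun i h ↦ hv (h ▸ (g i).2)
  let f : SimpleGraph.Copy (starGraphK (t + 1)) (⊤ : SimpleGraph V) :=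
    { toHom :=
        { toFun := Sum.elim (fun _ ↦ v) fun i ↦ g i
          map_rel' := by
            rintro (a | a) (b | b) h <;> simp at h
            · exact hg b
            · exact (hg a).symm }
      injective' := by
        rintro (a | a) (b | b) h
        · rw [Subsingleton.elim a b]
        · exact absurd h (hg b)
        · exact absurd h.symm (hg a)
        · exact congrArg _ (g.injective (Subtype.ext h)) }
  have h := hM.isCircuit_copy f
  rw [edgeSet_toSubgraph_star] at h
  have h1 : (univ.image fun i ↦ f.toHom (Sum.inr i)) = S := by
    ext u
    simp only [mem_image, mem_univ, true_and]
    constructor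
    · rintro ⟨i, rfl⟩
      exact (g i).2
    · exact fun hu ↦ ⟨g.symm ⟨u, hu⟩, by simp [f]⟩
  rwa [h1] at h

/-- The edges of the complete graph with an end in `A`. -/
def incidentEdges (A : Finset V) : Set (Sym2 V) :=
  {e | e ∈ (⊤ : SimpleGraph V).edgeSet ∧ ∃ a ∈ A, a ∈ e}

/-- Any t edges at v span all edges at v. Choosing them to include the edges from v to A, which are
already counted, a new vertex v adds at most t - |A| to the rank. -/
theorem IsGraphMatroid.eRk_incidentEdges_le [Fintype V] {t : ℕ} {M : Matroid (Sym2 V)}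
    (hM : IsGraphMatroid (starGraphK (t + 1)) M) (hV : t + 1 ≤ Fintype.card V)
    (A : Finset V) (hA : #A ≤ t) :
    M.eRk (incidentEdges A) ≤ (∑ i ∈ range #A, (t - i) : ℕ) := by
  induction A using Finset.induction_on with
  | empty => simp [incidentEdges]
  | insert v A hv ih =>
    rw [card_insert_of_notMem hv] at hA ⊢
    obtain ⟨L, hAL, hLv, hLt⟩ := exists_subsuperset_card_eq
      (s := A) (t := univ.erase v) (n := t)
      (fun a ha ↦ mem_erase.2 ⟨fun h ↦ hv (h ▸ ha), mem_univ a⟩) (by omega)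
      (by rw [card_erase_of_mem (mem_univ v), card_univ]; omega)
    have hvL : v ∉ L := fun h ↦ by simpa using hLv h
    have hsub : incidentEdges (insert v A) ⊆
        M.closure (incidentEdges A ∪ starEdges v (L \ A)) := by
      have hground : incidentEdges A ∪ starEdges v (L \ A) ⊆ M.E := by
        rw [hM.ground_eq]
        exact Set.union_subset (fun e he ↦ he.1)
          (starEdges_subset_edgeSet fun h ↦ hvL (mem_sdiff.1 h).1)
      have hL : (starEdges v L : Set (Sym2 V)) ⊆ incidentEdges A ∪ starEdges v (L \ A) := by
        intro e he
        have he' := starEdges_subset_edgeSet hvL he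
        obtain ⟨u, hu, rfl⟩ := mem_starEdges.1 (mem_coe.1 he)
        by_cases huA : u ∈ A
        · exact Or.inl ⟨he', u, huA, by simp⟩
        · exact Or.inr (mem_coe.2 (mem_starEdges.2 ⟨u, mem_sdiff.2 ⟨hu, huA⟩, rfl⟩))
      rintro e ⟨heE, a, ha, hae⟩
      rcases mem_insert.1 ha with rfl | ha
      · obtain ⟨u, rfl⟩ := hae
        have hau : a ≠ u := by simpa using heE
        by_cases huL : u ∈ L
        · exact M.subset_closure _ hground (hL (mem_coe.2 (mem_starEdges.2 ⟨u, huL, rfl⟩)))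
        · have hC := hM.isCircuit_star (v := a) (S := insert u L)
            (by simp [hau, hvL]) (by rw [card_insert_of_notMem huL, hLt])
          have h1 := hC.mem_closure_sdiff_singleton_of_mem (e := s(a, u))
            (mem_coe.2 (mem_starEdges.2 ⟨u, mem_insert_self u L, rfl⟩))
          refine M.closure_subset_closure (Set.Subset.trans ?_ hL) h1
          rintro e ⟨he, hne⟩
          obtain ⟨w, hw, rfl⟩ := mem_starEdges.1 (mem_coe.1 he)
          refine mem_coe.2 (mem_starEdges.2 ⟨w, ?_, rfl⟩)
          rcases mem_insert.1 hw with rfl | hw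
          · exact absurd rfl hne
          · exact hw
      · exact M.subset_closure _ hground (Or.inl ⟨heE, a, ha, hae⟩)
    calc M.eRk (incidentEdges (insert v A))
        ≤ M.eRk (incidentEdges A ∪ starEdges v (L \ A)) := by
          rw [← M.eRk_closure_eq (_ ∪ _)]
          exact M.eRk_mono hsub
      _ ≤ M.eRk (incidentEdges A) + (starEdges v (L \ A) : Set (Sym2 V)).encard :=
          M.eRk_union_le_eRk_add_encard _ _
      _ ≤ (∑ i ∈ range #A, (t - i) : ℕ) + (t - #A : ℕ) := by
          gcongr
          · exact ih (by omega)
          · rw [Set.encard_coe_eq_coe_finsetCard, card_starEdges, card_sdiff_of_subset hAL, hLt]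
      _ = (∑ i ∈ range (#A + 1), (t - i) : ℕ) := by
          rw [sum_range_succ]; push_cast; rfl

theorem two_mul_sum_range_sub {t m : ℕ} (h : m ≤ t) :
    2 * ∑ i ∈ range m, (t - i) + m * m = 2 * t * m + m := by
  induction m with
  | zero => simp
  | succ m ih =>
    have := ih (by omega)
    rw [sum_range_succ]
    obtain ⟨k, rfl⟩ := Nat.exists_eq_add_of_lt h
    have : m + k + 1 - m = k + 1 := by omega
    rw [this]
    nlinarith

/-- The edge set of the complete bipartite graph with sides `A` and `B`. -/
def crossEdges (A B : Finset V) : Finset (Sym2 V) := (A ×ˢ B).image fun p ↦ s(p.1, p.2)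

theorem mem_crossEdges {A B : Finset V} {e : Sym2 V} :
    e ∈ crossEdges A B ↔ ∃ a ∈ A, ∃ b ∈ B, s(a, b) = e := by
  simp [crossEdges, and_assoc]

theorem crossEdges_subset_edgeSet {A B : Finset V} (h : Disjoint A B) :
    (crossEdges A B : Set (Sym2 V)) ⊆ (⊤ : SimpleGraph V).edgeSet := by
  intro e he
  obtain ⟨a, ha, b, hb, rfl⟩ := mem_crossEdges.1 (mem_coe.1 he)
  simp only [SimpleGraph.mem_edgeSet, SimpleGraph.top_adj]
  rintro rfl
  exact disjoint_left.1 h ha hb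

theorem card_crossEdges {A B : Finset V} (h : Disjoint A B) :
    #(crossEdges A B) = #A * #B := by
  rw [crossEdges, card_image_of_injOn, card_product]
  rintro ⟨a, b⟩ hab ⟨c, d⟩ hcd heq
  simp only [coe_product, Set.mem_prod, mem_coe] at hab hcd
  simp only [Sym2.eq_iff] at heq
  rcases heq with ⟨rfl, rfl⟩ | ⟨rfl, rfl⟩
  · rfl
  · exact absurd hcd.2 (disjoint_left.1 h hab.1)

theorem card_filter_crossEdges_le {A B : Finset V} (h : Disjoint A B) {k : ℕ} (hA : #A ≤ k)
    (hB : #B ≤ k) (x : V) : #((crossEdges A B).filter fun e ↦ x ∈ e) ≤ k := by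
  have hsub : ((crossEdges A B).filter fun e ↦ x ∈ e) ⊆
      starEdges x (if x ∈ A then B else A) := by
    intro e he
    rw [mem_filter] at he
    obtain ⟨⟨a, ha, b, hb, rfl⟩, hx⟩ := And.imp_left mem_crossEdges.1 he
    rcases Sym2.mem_iff.1 hx with rfl | rfl
    · rw [if_pos ha]
      exact mem_starEdges.2 ⟨b, hb, rfl⟩
    · rw [if_neg (disjoint_right.1 h hb)]
      exact mem_starEdges.2 ⟨a, ha, Sym2.eq_swap⟩
  refine (card_le_card hsub).trans ?_
  rw [card_starEdges]
  split_ifs <;> assumption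

/-- The edge set of the complete graph on `T`. -/
def cliqueEdges (T : Finset V) : Finset (Sym2 V) := T.offDiag.image fun p ↦ s(p.1, p.2)

theorem mem_cliqueEdges {T : Finset V} {e : Sym2 V} :
    e ∈ cliqueEdges T ↔ ∃ a ∈ T, ∃ b ∈ T, a ≠ b ∧ s(a, b) = e := by
  simp [cliqueEdges, and_assoc]

theorem card_cliqueEdges (T : Finset V) : #(cliqueEdges T) = (#T).choose 2 :=
  Sym2.card_image_offDiag T

theorem cliqueEdges_subset_edgeSet (T : Finset V) :
    (cliqueEdges T : Set (Sym2 V)) ⊆ (⊤ : SimpleGraph V).edgeSet := by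
  intro e he
  obtain ⟨a, -, b, -, hab, rfl⟩ := mem_cliqueEdges.1 (mem_coe.1 he)
  simpa using hab

/-- In a `K_{1,t+1}`-matroid, a clique `K_{t+1}` and a disjoint-sided `K_{3,t-1}` covering it
are not both independent. -/
theorem IsGraphMatroid.not_indep_crossEdges [Fintype V] {t : ℕ} {M : Matroid (Sym2 V)}
    (hM : IsGraphMatroid (starGraphK (t + 1)) M) (ht : 3 ≤ t) (hV : t + 1 ≤ Fintype.card V)
    {A B T : Finset V} (hA : #A = 3) (hB : #B = t - 1) (hAB : Disjoint A B)
    (hT : #T = t + 1) (hTAB : T ⊆ A ∪ B) (hTi : M.Indep (cliqueEdges T)) :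
    ¬ M.Indep (crossEdges A B) := by
  intro hC
  have h1 := M.eRk_inter_add_eRk_union_le (incidentEdges A) (incidentEdges B)
  have h2 := hM.eRk_incidentEdges_le hV A (by omega)
  have h3 := hM.eRk_incidentEdges_le hV B (by omega)
  -- The bipartite graph lies in the intersection and the clique in the union, so submodularity
  -- bounds the sum of their sizes.
  have h4 : ((3 * (t - 1) : ℕ) : ℕ∞) ≤ M.eRk (incidentEdges A ∩ incidentEdges B) := by
    rw [← hA, ← hB, ← card_crossEdges hAB, ← Set.encard_coe_eq_coe_finsetCard]
    refine hC.encard_le_eRk_of_subset fun e he ↦ ?_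
    have heE := crossEdges_subset_edgeSet hAB he
    obtain ⟨a, ha, b, hb, rfl⟩ := mem_crossEdges.1 (mem_coe.1 he)
    exact ⟨⟨heE, a, ha, by simp⟩, heE, b, hb, by simp⟩
  have h5 : (((t + 1).choose 2 : ℕ) : ℕ∞) ≤ M.eRk (incidentEdges A ∪ incidentEdges B) := by
    rw [← hT, ← card_cliqueEdges, ← Set.encard_coe_eq_coe_finsetCard]
    refine hTi.encard_le_eRk_of_subset fun e he ↦ ?_
    have heE := cliqueEdges_subset_edgeSet T he
    obtain ⟨a, ha, b, hb, -, rfl⟩ := mem_cliqueEdges.1 (mem_coe.1 he)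
    rcases mem_union.1 (hTAB ha) with h | h
    · exact Or.inl ⟨heE, a, h, by simp⟩
    · exact Or.inr ⟨heE, a, h, by simp⟩
  have h6 := (add_le_add h4 h5).trans (h1.trans (add_le_add h2 h3))
  rw [hA, hB] at h6
  norm_cast at h6
  -- The upper bounds are 3t - 3 for A and C(t+1,2) - 1 for B; that last 1 gives the contradiction.
  have h7 := two_mul_sum_range_sub (t := t) (m := 3) (by omega)
  have h8 := two_mul_sum_range_sub (t := t) (m := t - 1) (by omega)
  have h9 := Nat.triangle_succ t
  rw [Nat.choose_two_right, h9] at h6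
  have h10 := Nat.div_mul_cancel (Nat.even_mul_pred_self t).two_dvd
  obtain ⟨k, rfl⟩ := Nat.exists_eq_add_of_le' ht
  simp only [Nat.add_sub_cancel, show k + 3 - 1 = k + 2 by omega] at *
  nlinarith

end Star

/-! ### A linear matroid in which `K_{t+1}` is independent -/

section Linear

open Polynomial

variable {n : ℕ}

/-- The edge `uv` as the function `q ↦ q(u) q(v)` on the polynomials of degree less than `t`. -/
noncomputable def evalProd (t : ℕ) (e : Sym2 (Fin n)) : degreeLT ℝ t → ℝ :=
  Sym2.lift ⟨fun (u v : Fin n) q ↦ (q : ℝ[X]).eval (u : ℝ) * (q : ℝ[X]).eval (v : ℝ),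
    fun _ _ ↦ funext fun _ ↦ mul_comm _ _⟩ e

theorem evalProd_mk (t : ℕ) (u v : Fin n) (q : degreeLT ℝ t) :
    evalProd t s(u, v) q = (q : ℝ[X]).eval (u : ℝ) * (q : ℝ[X]).eval (v : ℝ) := rfl

/-- The rank of a set of edges represented by `evalProd`. -/
noncomputable def evalRank (t : ℕ) (F : Finset (Sym2 (Fin n))) : ℕ :=
  Module.finrank ℝ (Submodule.span ℝ (evalProd t '' (F : Set (Sym2 (Fin n)))))

theorem isRankFun_evalRank (t : ℕ) : IsRankFun (evalRank (n := n) t) := by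
  have hfin (F : Finset (Sym2 (Fin n))) : FiniteDimensional ℝ
      (Submodule.span ℝ (evalProd t '' (F : Set (Sym2 (Fin n))))) :=
    FiniteDimensional.span_of_finite ℝ (F.finite_toSet.image _)
  refine ⟨fun F ↦ ?_, fun F G h ↦ ?_, fun F G ↦ ?_⟩
  · classical
    rw [evalRank, ← coe_image]
    exact (finrank_span_finset_le_card _).trans card_image_le
  · exact Submodule.finrank_mono (Submodule.span_mono (Set.image_mono (coe_subset.2 h)))
  · have h := Submodule.finrank_sup_add_finrank_inf_eq
      (Submodule.span ℝ (evalProd t '' (F : Set (Sym2 (Fin n)))))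
      (Submodule.span ℝ (evalProd t '' (G : Set (Sym2 (Fin n)))))
    rw [← Submodule.span_union, ← Set.image_union, ← coe_union] at h
    unfold evalRank
    rw [← h]
    gcongr
    have := Submodule.finiteDimensional_inf_left
      (Submodule.span ℝ (evalProd t '' (F : Set (Sym2 (Fin n)))))
      (Submodule.span ℝ (evalProd t '' (G : Set (Sym2 (Fin n)))))
    exact Submodule.finrank_mono (le_inf
      (Submodule.span_mono (Set.image_mono (coe_subset.2 inter_subset_left)))
      (Submodule.span_mono (Set.image_mono (coe_subset.2 inter_subset_right))))

theorem evalRank_starEdges_le (t : ℕ) (v : Fin n) (S : Finset (Fin n)) :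
    evalRank t (starEdges v S) ≤ t := by
  -- Every edge at v is evaluation at v times a linear functional, so the star lies in the image of
  -- a t-dimensional dual space.
  let L : (Module.Dual ℝ (degreeLT ℝ t)) →ₗ[ℝ] (degreeLT ℝ t → ℝ) :=
    { toFun := fun φ q ↦ (q : ℝ[X]).eval (v : ℝ) * φ q
      map_add' := fun φ ψ ↦ by ext q; simp [mul_add]
      map_smul' := fun c φ ↦ by ext q; simp [mul_left_comm] }
  have hfin : Module.finrank ℝ (degreeLT ℝ t) = t := by
    rw [(degreeLTEquiv ℝ t).finrank_eq, Module.finrank_fin_fun]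
  have : FiniteDimensional ℝ (degreeLT ℝ t) := Module.Finite.equiv (degreeLTEquiv ℝ t).symm
  have hle : Submodule.span ℝ (evalProd t '' (starEdges v S : Set (Sym2 (Fin n)))) ≤
      LinearMap.range L := by
    rw [Submodule.span_le]
    rintro _ ⟨e, he, rfl⟩
    obtain ⟨u, -, rfl⟩ := mem_starEdges.1 (mem_coe.1 he)
    exact ⟨(leval (u : ℝ)).comp (degreeLT ℝ t).subtype, rfl⟩
  calc evalRank t (starEdges v S) ≤ Module.finrank ℝ (LinearMap.range L) :=
        Submodule.finrank_mono hle
    _ ≤ Module.finrank ℝ (Module.Dual ℝ (degreeLT ℝ t)) := LinearMap.finrank_range_le L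
    _ = t := by rw [Subspace.dual_finrank_eq, hfin]

/-- Edges are independent when each edge avoids a set of fewer than `t` vertices which covers all
the other edges. -/
theorem evalRank_eq_card {t : ℕ} {F : Finset (Sym2 (Fin n))}
    (h : ∀ a b : Fin n, s(a, b) ∈ F → ∃ S : Finset (Fin n), #S < t ∧ a ∉ S ∧ b ∉ S ∧
      ∀ e ∈ F, e ≠ s(a, b) → ∃ x ∈ S, x ∈ e) : evalRank t F = #F := by
  have hli : LinearIndepOn ℝ (evalProd t) (F : Set (Sym2 (Fin n))) := by
    rw [linearIndepOn_finset_iff]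
    intro c hc e he
    induction e with | _ a b
    obtain ⟨S, hS, haS, hbS, hcov⟩ := h a b he
    let p : ℝ[X] := ∏ x ∈ S, (X - C (x : ℝ))
    have hp : p ∈ degreeLT ℝ t := by
      rw [mem_degreeLT, degree_prod,
        sum_congr rfl fun (x : Fin n) _ ↦ degree_X_sub_C (x : ℝ)]
      simpa using hS
    have hev : ∀ y : Fin n, p.eval (y : ℝ) = 0 ↔ y ∈ S := by
      intro y
      simp only [p, eval_prod, eval_sub, eval_X, eval_C, prod_eq_zero_iff, sub_eq_zero,
        Nat.cast_inj, Fin.val_inj]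
      exact ⟨fun ⟨x, hx, hyx⟩ ↦ hyx ▸ hx, fun hy ↦ ⟨y, hy, rfl⟩⟩
    -- Since p vanishes exactly on S among the vertices, evaluating the linear relation at p kills
    -- every term except that of ab.
    have h1 := congrFun hc ⟨p, hp⟩
    rw [Finset.sum_apply, sum_eq_single s(a, b)] at h1
    · simp only [Pi.smul_apply, smul_eq_mul, evalProd_mk, Pi.zero_apply, mul_eq_zero, hev] at h1
      tauto
    · intro e he hne
      obtain ⟨x, hx, y, rfl⟩ := hcov e he hne
      simp [evalProd_mk, (hev x).2 hx]
    · exact fun h ↦ absurd he h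
  classical
  have h2 := finrank_span_finset_eq_card (R := ℝ) (s := F.image (evalProd t))
    (by rw [coe_image]; exact hli.id_image)
  rw [evalRank, ← coe_image, h2, card_image_of_injOn hli.injOn]

theorem exists_isGraphMatroid_star_indep_clique (n t : ℕ) :
    ∃ M : Matroid (Sym2 (Fin n)), IsGraphMatroid (starGraphK (t + 1)) M ∧
      ∀ T : Finset (Fin n), #T = t + 1 → M.Indep (cliqueEdges T) := by
  obtain ⟨M, hE, hM⟩ :=
    (isRankFun_evalRank (n := n) t).exists_matroid (⊤ : SimpleGraph (Fin n)).edgeSet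
  refine ⟨M, isGraphMatroid_star_of_indep hE (fun v S hv hS ↦ ?_) fun v S hv hS ↦ ?_,
    fun T hT ↦ ?_⟩
  · rw [hM, card_starEdges, hS]
    have := evalRank_starEdges_le t v S
    omega
  · refine (hM _).2 ⟨evalRank_eq_card fun a b hab ↦ ?_, starEdges_subset_edgeSet hv⟩
    obtain ⟨u, hu, hab⟩ := mem_starEdges.1 hab
    refine ⟨S.erase u, ?_, ?_, ?_, fun e he hne ↦ ?_⟩
    · have := card_erase_lt_of_mem hu
      omega
    · rcases Sym2.eq_iff.1 hab with ⟨rfl, rfl⟩ | ⟨rfl, rfl⟩ <;> simp [hv]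
    · rcases Sym2.eq_iff.1 hab with ⟨rfl, rfl⟩ | ⟨rfl, rfl⟩ <;> simp [hv]
    · obtain ⟨w, hw, rfl⟩ := mem_starEdges.1 he
      exact ⟨w, mem_erase.2 ⟨fun h ↦ hne (by rw [h, hab]), hw⟩, by simp⟩
  · refine (hM _).2 ⟨evalRank_eq_card fun a b hab ↦ ?_, cliqueEdges_subset_edgeSet T⟩
    have hab' : a ∈ T ∧ b ∈ T ∧ a ≠ b := by
      obtain ⟨x, hx, y, hy, hxy, h⟩ := mem_cliqueEdges.1 hab
      rcases Sym2.eq_iff.1 h with ⟨rfl, rfl⟩ | ⟨rfl, rfl⟩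
      · exact ⟨hx, hy, hxy⟩
      · exact ⟨hy, hx, hxy.symm⟩
    refine ⟨(T.erase a).erase b, ?_, by simp, by simp, fun e he hne ↦ ?_⟩
    · rw [card_erase_of_mem (mem_erase.2 ⟨hab'.2.2.symm, hab'.2.1⟩), card_erase_of_mem hab'.1]
      have : 1 < #T := one_lt_card.2 ⟨a, hab'.1, b, hab'.2.1, hab'.2.2⟩
      omega
    · obtain ⟨x, hx, y, hy, hxy, rfl⟩ := mem_cliqueEdges.1 he
      by_cases hxa : x ≠ a ∧ x ≠ b
      · exact ⟨x, by simp [hxa, hx], by simp⟩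
      · refine ⟨y, ?_, by simp⟩
        have : y ≠ a ∧ y ≠ b := by
          constructor
          · rintro rfl
            refine hne ?_
            rw [Sym2.eq_swap]
            congr
            tauto
          · rintro rfl
            refine hne ?_
            congr
            tauto
        simp [this, hy]

end Linear

/-! ### A counting matroid in which `K_{3,t-1}` is independent -/

section Count

variable {V : Type*} [DecidableEq V] [Fintype V]

/-- The bound on the number of edges meeting a set of `m` vertices. -/
def coverWeight (t : ℕ) : ℕ → ℕ
  | 0 => 0
  | 1 => t
  | 2 => 2 * t - 1
  -- The weights are the partial sums of t + (t-1) + (t-2), frozen from three vertices on; the cap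
  -- equals the size of `K_{3,t-1}`.
  | _ => 3 * t - 3

theorem coverWeight_of_three_le {t m : ℕ} (hm : 3 ≤ m) : coverWeight t m = 3 * t - 3 := by
  obtain ⟨k, rfl⟩ := Nat.exists_eq_add_of_le' hm
  rfl

theorem coverWeight_le {t : ℕ} (ht : 2 ≤ t) (m : ℕ) : coverWeight t m ≤ 3 * t - 3 := by
  rcases m with _ | _ | _ | m <;> simp only [coverWeight] <;> omega

/-- Here a, b, c stand for |X \ Y|, |Y \ X|, |X ∩ Y|. The slack a * b pays for the edges between the
two differences. Two disjoint pairs force t ≥ 3. -/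
theorem coverWeight_submod {t : ℕ} (ht : 3 ≤ t) {a b c : ℕ} (ha : a + c ≤ 2) (hb : b + c ≤ 2) :
    coverWeight t (a + b + c) + coverWeight t c + a * b ≤
      coverWeight t (a + c) + coverWeight t (b + c) := by
  have h1 : a ≤ 2 := by omega
  have h2 : b ≤ 2 := by omega
  have h3 : c ≤ 2 := by omega
  interval_cases c <;> interval_cases a <;> interval_cases b <;>
    simp only [coverWeight] at * <;> omega

/-- The size bound for `F` given by the edges avoiding `X` and the weight of `X`. -/
def coverCost (t : ℕ) (F : Finset (Sym2 V)) (X : Finset V) : ℕ :=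
  #(F.filter fun e ↦ ∀ x ∈ X, x ∉ e) + coverWeight t #X

/-- The least size bound for `F`. -/
def coverRank (t : ℕ) (F : Finset (Sym2 V)) : ℕ :=
  (univ : Finset (Finset V)).inf' univ_nonempty (coverCost t F)

theorem coverRank_le (t : ℕ) (F : Finset (Sym2 V)) (X : Finset V) :
    coverRank t F ≤ coverCost t F X :=
  inf'_le _ (mem_univ X)

theorem exists_coverCost_eq (t : ℕ) (F : Finset (Sym2 V)) :
    ∃ X, coverRank t F = coverCost t F X := by
  obtain ⟨X, -, h⟩ := exists_mem_eq_inf' (univ_nonempty (α := Finset V)) (coverCost t F)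
  exact ⟨X, h⟩

theorem coverCost_mono {t : ℕ} {F G : Finset (Sym2 V)} (h : F ⊆ G) (X : Finset V) :
    coverCost t F X ≤ coverCost t G X :=
  Nat.add_le_add_right (card_le_card (filter_subset_filter _ h)) _

theorem coverRank_mono {t : ℕ} {F G : Finset (Sym2 V)} (h : F ⊆ G) :
    coverRank t F ≤ coverRank t G := by
  obtain ⟨X, hX⟩ := exists_coverCost_eq t G
  rw [hX]
  exact (coverRank_le t F X).trans (coverCost_mono h X)

theorem coverRank_le_max {t : ℕ} (ht : 2 ≤ t) (F : Finset (Sym2 V)) :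
    coverRank t F ≤ 3 * t - 3 := by
  refine (coverRank_le t F univ).trans ?_
  have : F.filter (fun e ↦ ∀ x ∈ (univ : Finset V), x ∉ e) = ∅ := by
    refine filter_eq_empty_iff.2 fun e _ h ↦ ?_
    induction e with | _ a b
    exact h a (mem_univ a) (by simp)
  rw [coverCost, this, card_empty, zero_add]
  exact coverWeight_le ht _

theorem coverCost_submod {t : ℕ} (ht : 3 ≤ t) (F G : Finset (Sym2 V)) {X Y : Finset V}
    (hX : #X ≤ 2) (hY : #Y ≤ 2) :
    coverCost t (F ∪ G) (X ∪ Y) + coverCost t (F ∩ G) (X ∩ Y) ≤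
      coverCost t F X + coverCost t G Y := by
  have hw := coverWeight_submod ht (a := #(X \ Y)) (b := #(Y \ X)) (c := #(X ∩ Y))
    (by rw [card_sdiff_add_card_inter]; exact hX)
    (by rw [inter_comm, card_sdiff_add_card_inter]; exact hY)
  have hXY : #(X \ Y) + #(Y \ X) + #(X ∩ Y) = #(X ∪ Y) := by
    have h1 := card_union_add_card_inter X Y
    have h2 := card_sdiff_add_card_inter X Y
    have h3 := card_sdiff_add_card_inter Y X
    rw [inter_comm] at h3
    omega
  rw [hXY, card_sdiff_add_card_inter, inter_comm X Y, card_sdiff_add_card_inter] at hw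
  rw [inter_comm Y X] at hw
  have hC : #(crossEdges (X \ Y) (Y \ X)) ≤ #(X \ Y) * #(Y \ X) :=
    card_image_le.trans (card_product _ _).le
  set P := F.filter fun e ↦ ∀ x ∈ X, x ∉ e with hP
  set Q := G.filter fun e ↦ ∀ x ∈ Y, x ∉ e with hQ
  set U := (F ∪ G).filter fun e ↦ ∀ x ∈ X ∪ Y, x ∉ e with hU
  set I := (F ∩ G).filter fun e ↦ ∀ x ∈ X ∩ Y, x ∉ e with hI
  -- An edge that avoids X ∩ Y but meets both X and Y must join X \ Y to Y \ X.
  have h1 : U ∪ I ⊆ (P ∪ Q) ∪ crossEdges (X \ Y) (Y \ X) := by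
    intro e he
    rcases mem_union.1 he with he | he
    · rw [hU, mem_filter] at he
      refine mem_union_left _ ?_
      rcases mem_union.1 he.1 with h | h
      · exact mem_union_left _ (mem_filter.2 ⟨h, fun x hx ↦ he.2 x (mem_union_left _ hx)⟩)
      · exact mem_union_right _ (mem_filter.2 ⟨h, fun x hx ↦ he.2 x (mem_union_right _ hx)⟩)
    · rw [hI, mem_filter, mem_inter] at he
      by_cases hx : ∀ x ∈ X, x ∉ e
      · exact mem_union_left _ (mem_union_left _ (mem_filter.2 ⟨he.1.1, hx⟩))
      by_cases hy : ∀ y ∈ Y, y ∉ e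
      · exact mem_union_left _ (mem_union_right _ (mem_filter.2 ⟨he.1.2, hy⟩))
      push Not at hx hy
      obtain ⟨x, hxX, hxe⟩ := hx
      obtain ⟨y, hyY, hye⟩ := hy
      have hxY : x ∉ Y := fun h ↦ he.2 x (mem_inter.2 ⟨hxX, h⟩) hxe
      have hyX : y ∉ X := fun h ↦ he.2 y (mem_inter.2 ⟨h, hyY⟩) hye
      have hxy : x ≠ y := fun h ↦ hxY (h ▸ hyY)
      refine mem_union_right _ (mem_crossEdges.2
        ⟨x, mem_sdiff.2 ⟨hxX, hxY⟩, y, mem_sdiff.2 ⟨hyY, hyX⟩, ?_⟩)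
      exact ((Sym2.mem_and_mem_iff hxy).1 ⟨hxe, hye⟩).symm
  have h2 : U ∩ I ⊆ P ∩ Q := by
    intro e he
    rw [hU, hI, mem_inter, mem_filter, mem_filter, mem_inter] at he
    exact mem_inter.2 ⟨mem_filter.2 ⟨he.2.1.1, fun x hx ↦ he.1.2 x (mem_union_left _ hx)⟩,
      mem_filter.2 ⟨he.2.1.2, fun x hx ↦ he.1.2 x (mem_union_right _ hx)⟩⟩
  have h3 := card_union_add_card_inter U I
  have h4 := card_union_add_card_inter P Q
  have h5 := (card_le_card h1).trans (card_union_le _ _)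
  have h6 := card_le_card h2
  simp only [coverCost, ← hP, ← hQ, ← hU, ← hI]
  omega

theorem isRankFun_coverRank {t : ℕ} (ht : 3 ≤ t) : IsRankFun (coverRank (V := V) t) where
  le_card F := (coverRank_le t F ∅).trans (by simp [coverCost, coverWeight])
  mono F G h := coverRank_mono h
  submod F G := by
    obtain ⟨X, hX⟩ := exists_coverCost_eq t F
    obtain ⟨Y, hY⟩ := exists_coverCost_eq t G
    have hmax := coverRank_le_max (by omega : 2 ≤ t) (F ∪ G)
    have hF := coverRank_mono (t := t) (inter_subset_left : F ∩ G ⊆ F)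
    have hG := coverRank_mono (t := t) (inter_subset_right : F ∩ G ⊆ G)
    -- If X has at least three vertices, the rank of F already reaches the global maximum 3t - 3,
    -- and monotonicity suffices.
    by_cases h3 : 3 ≤ #X
    · have := coverWeight_of_three_le (t := t) h3
      rw [coverCost] at hX
      omega
    by_cases h4 : 3 ≤ #Y
    · have := coverWeight_of_three_le (t := t) h4
      rw [coverCost] at hY
      omega
    have := coverCost_submod ht F G (X := X) (Y := Y) (by omega) (by omega)
    have := coverRank_le t (F ∪ G) (X ∪ Y)
    have := coverRank_le t (F ∩ G) (X ∩ Y)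
    omega

theorem coverRank_eq_card {t : ℕ} (ht : 3 ≤ t) {F : Finset (Sym2 V)}
    (h : ∀ X : Finset V, #(F.filter fun e ↦ ∃ x ∈ X, x ∈ e) ≤ coverWeight t #X) :
    coverRank t F = #F := by
  refine ((isRankFun_coverRank ht).le_card F).antisymm ?_
  obtain ⟨X, hX⟩ := exists_coverCost_eq t F
  have h1 := card_filter_add_card_filter_not (s := F) fun e ↦ ∃ x ∈ X, x ∈ e
  have h2 := h X
  push Not at h1
  rw [hX, coverCost]
  omega

theorem exists_isGraphMatroid_star_indep_crossEdges (V : Type*) [DecidableEq V] [Fintype V]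
    {t : ℕ} (ht : 4 ≤ t) :
    ∃ M : Matroid (Sym2 V), IsGraphMatroid (starGraphK (t + 1)) M ∧
      ∀ A B : Finset V, Disjoint A B → #A = 3 → #B = t - 1 → M.Indep (crossEdges A B) := by
  have ht3 : 3 ≤ t := by omega
  obtain ⟨M, hE, hM⟩ :=
    (isRankFun_coverRank (V := V) ht3).exists_matroid (⊤ : SimpleGraph V).edgeSet
  refine ⟨M, isGraphMatroid_star_of_indep hE (fun v S hv hS ↦ ?_) fun v S hv hS ↦ ?_,
    fun A B hAB hA hB ↦ ?_⟩
  · rw [hM, card_starEdges, hS]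
    have h1 := coverRank_le t (starEdges v S) {v}
    have h2 : (starEdges v S).filter (fun e ↦ ∀ x ∈ ({v} : Finset V), x ∉ e) = ∅ := by
      refine filter_eq_empty_iff.2 fun e he h ↦ ?_
      obtain ⟨u, -, rfl⟩ := mem_starEdges.1 he
      exact h v (mem_singleton_self v) (by simp)
    rw [coverCost, h2, card_empty, card_singleton, zero_add] at h1
    have h3 : coverWeight t 1 = t := rfl
    omega
  · refine (hM _).2 ⟨coverRank_eq_card ht3 fun X ↦ ?_, starEdges_subset_edgeSet hv⟩
    rcases X.eq_empty_or_nonempty with rfl | hX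
    · simp
    have h1 := card_filter_le (starEdges v S) fun e ↦ ∃ x ∈ X, x ∈ e
    rw [card_starEdges, hS] at h1
    refine h1.trans ?_
    obtain ⟨m, hm⟩ := Nat.exists_eq_add_of_le' (card_pos.2 hX)
    rw [hm]
    rcases m with _ | _ | m <;> simp only [coverWeight] <;> omega
  · refine (hM _).2 ⟨coverRank_eq_card ht3 fun X ↦ ?_, crossEdges_subset_edgeSet hAB⟩
    -- Degrees in `K_{3,t-1}` are 3 and t - 1, so t ≥ 4 makes t - 1 a bound for both.
    have hdeg := card_filter_crossEdges_le hAB (k := t - 1) (by omega) hB.le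
    by_cases h3 : 3 ≤ #X
    · rw [coverWeight_of_three_le h3]
      refine (card_filter_le _ _).trans ?_
      rw [card_crossEdges hAB, hA, hB]
      omega
    have h1 : #((crossEdges A B).filter fun e ↦ ∃ x ∈ X, x ∈ e) ≤ #X * (t - 1) := by
      have : ((crossEdges A B).filter fun e ↦ ∃ x ∈ X, x ∈ e) =
          X.biUnion fun x ↦ (crossEdges A B).filter fun e ↦ x ∈ e := by
        ext e
        simp only [mem_filter, mem_biUnion]
        tauto
      rw [this]
      exact card_biUnion_le_card_mul _ _ _ fun x _ ↦ hdeg x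
    refine h1.trans ?_
    have h2 : #X ≤ 2 := by omega
    interval_cases #X <;> simp only [coverWeight] <;> omega

end Count

/-! ### Maximal matroids and the conclusion -/

/-- On a finite vertex set every `H`-matroid lies below a maximal one. -/
theorem IsGraphMatroid.exists_le_maximal {V W : Type*} [Finite V] {H : SimpleGraph W}
    {M : Matroid (Sym2 V)} (hM : IsGraphMatroid H M) :
    ∃ N, IsMaximalGraphMatroid H N ∧ M.WeakLE N := by
  have hinj : Function.Injective fun N : Matroid (Sym2 V) ↦ (N.E, {I | N.Indep I}) := by
    intro N N' h
    simp only [Prod.mk.injEq] at h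
    exact Matroid.ext_indep h.1 fun I _ ↦ Set.ext_iff.1 h.2 I
  have : Finite (Matroid (Sym2 V)) := Finite.of_injective _ hinj
  -- Among the finitely many candidates above M, one with the most independent sets is maximal.
  obtain ⟨N, ⟨hN, hMN⟩, hmax⟩ := Set.exists_max_image
    {N : Matroid (Sym2 V) | IsGraphMatroid H N ∧ M.WeakLE N}
    (fun N ↦ {I | N.Indep I}.ncard) (Set.toFinite _) ⟨M, hM, rfl, fun _ h ↦ h⟩
  refine ⟨N, ⟨hN, fun N' hN' hle ↦ ?_⟩, hMN⟩
  have h1 := hmax N' ⟨hN', hMN.1.trans hle.1, fun I hI ↦ hle.2 I (hMN.2 I hI)⟩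
  have h2 : {I | N.Indep I} = {I | N'.Indep I} :=
    Set.eq_of_subset_of_ncard_le hle.2 h1 (Set.toFinite _)
  exact Matroid.ext_indep hle.1.symm fun I _ ↦ (Set.ext_iff.1 h2 I).symm

theorem theorem2p9 (t n : ℕ) (ht : 4 ≤ t) (hn : t + 2 ≤ n) :
    ∃ M₁ M₂ : Matroid (Sym2 (Fin n)),
      IsMaximalGraphMatroid (starGraphK (t + 1)) M₁ ∧
      IsMaximalGraphMatroid (starGraphK (t + 1)) M₂ ∧
      M₁ ≠ M₂ := by
  obtain ⟨M, hM, hMclique⟩ := exists_isGraphMatroid_star_indep_clique n t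
  obtain ⟨N, hN, hNcross⟩ := exists_isGraphMatroid_star_indep_crossEdges (Fin n) ht
  obtain ⟨M', hM', hMM'⟩ := hM.exists_le_maximal
  obtain ⟨N', hN', hNN'⟩ := hN.exists_le_maximal
  refine ⟨M', N', hM', hN', ?_⟩
  rintro rfl
  -- The t + 2 vertices of Z hold both `K_{3,t-1}` and `K_{t+1}`; this is where n ≥ t + 2 enters.
  obtain ⟨Z, -, hZ⟩ := exists_subset_card_eq (s := (univ : Finset (Fin n))) (n := t + 2)
    (by simpa using hn)
  obtain ⟨A, hAZ, hA⟩ := exists_subset_card_eq (s := Z) (n := 3) (by omega)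
  obtain ⟨T, hTZ, hT⟩ := exists_subset_card_eq (s := Z) (n := t + 1) (by omega)
  have hB : #(Z \ A) = t - 1 := by
    rw [card_sdiff_of_subset hAZ]
    omega
  refine hM'.1.not_indep_crossEdges (by omega) (by rw [Fintype.card_fin]; omega) hA hB
    disjoint_sdiff hT (by rwa [union_sdiff_of_subset hAZ])
    (hMM'.2 _ (hMclique T hT)) (hNN'.2 _ (hNcross A (Z \ A) disjoint_sdiff hA hB))
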